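/- An algebra is a set $A$ with a family (possibly infinite) of finitary basic operations. It is idempotent if every basic operation $f$ satisfies $f(x,\dots,x)=x$ for all $x\in A$. A subuniverse of $\mathbf A$ is a (possibly empty) subset of $A$ closed under the basic operations; for $n\ge 1$ the operations of $\mathbf A^n$ act coordinatewise. For a subuniverse $B$ of $\mathbf A$: - $B$ absorbs $\mathbf A$ if there are $n$ and an $n$-ary term $t$ of $\mathbf A$ that is idempotent on $A$ ($t(x,\dots,x)=x$) such that $t(b_1,\dots,b_{i-1},a,b_{i+1},\dots,b_n)\in B$ for all $i\in\{1,\dots,n\}$, all $b_1,\dots,b_n\in B$ and all $a\in A$. - $B$ Jónsson absorbs $\mathbf A$ if there are $n\ge 0$ and ternary terms $d_0,\dots,d_n$ of $\mathbf A$ such that $d_i(b,a,b')\in B$ for all $0\le i\le n$, $b,b'\in B$, $a\in A$; $d_i(x,y,y)=d_{i+1}(x,x,y)$ for all $0\le i<n$ and $x,y\in A$; and $d_0(x,y,z)=x$, $d_n(x,y,z)=z$ for all $x,y,z\in A$. - A $B$-blocker of $\mathbf A$ is a pair $(C,D)$ such that $D$ is a subuniverse of $\mathbf A$, $\emptyset\ne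 C\subseteq D$, $C\cap B=\emptyset$, $D\cap B\neq\emptyset$, and for every $n\ge 1$ the set $D^n\setminus(D\setminus C)^n$ is a subuniverse of $\mathbf A^n$. **Theorem.** Let $\mathbf A$ be a finite idempotent algebra and $B$ a subuniverse of $\mathbf A$. Then $B$ absorbs $\mathbf A$ if and only if $B$ Jónsson absorbs $\mathbf A$ and $\mathbf A$ has no $B$-blocker. -/

import Mathlib

universe u v w

namespace Absorption

open FirstOrder FirstOrder.Language

section

variable (L : FirstOrder.Language.{u, v})

/-- The algebra `A` is idempotent: every basic operation `f` satisfies `f(x, …, x) = x`. -/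
def IsIdempotentAlgebra (A : Type w) [L.Structure A] : Prop :=
  ∀ (n : ℕ) (f : L.Functions n) (x : A), Structure.funMap f (fun _ : Fin n => x) = x

/-- `R ⊆ A ^ I` is a subuniverse of the power `A ^ I`, whose basic operations are those of `A`
acting coordinatewise. -/
def IsSubpower {A : Type w} [L.Structure A] {I : Type*} (R : Set (I → A)) : Prop :=
  ∀ (k : ℕ) (f : L.Functions k) (r : Fin k → I → A), (∀ j, r j ∈ R) →
    (fun i => Structure.funMap f (fun j => r j i)) ∈ R

end

section

variable {L : FirstOrder.Language.{u, v}} {A : Type w} [L.Structure A]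

/-- `B` absorbs `A`: some idempotent term `t` of `A` returns a value in `B` whenever all but at
most one of its arguments are in `B`. -/
def Absorbs (B : L.Substructure A) : Prop :=
  ∃ (n : ℕ) (t : L.Term (Fin n)),
    (∀ x : A, t.realize (fun _ => x) = x) ∧
    ∀ b : Fin n → A, (∀ j, b j ∈ B) → ∀ (i : Fin n) (a : A),
      t.realize (Function.update b i a) ∈ B

/-- `B` Jónsson absorbs `A`: there is a chain `d 0, …, d n` of ternary terms of `A` with
`d i (B, A, B) ⊆ B` for `i ≤ n`, `d i (x, y, y) = d (i + 1) (x, x, y)` for `i < n`,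
`d 0 (x, y, z) = x` and `d n (x, y, z) = z`. -/
def JonssonAbsorbs (B : L.Substructure A) : Prop :=
  ∃ (n : ℕ) (d : ℕ → L.Term (Fin 3)),
    (∀ i ≤ n, ∀ b ∈ B, ∀ a : A, ∀ b' ∈ B, (d i).realize ![b, a, b'] ∈ B) ∧
    (∀ i < n, ∀ x y : A, (d i).realize ![x, y, y] = (d (i + 1)).realize ![x, x, y]) ∧
    (∀ x y z : A, (d 0).realize ![x, y, z] = x) ∧
    (∀ x y z : A, (d n).realize ![x, y, z] = z)

/-- `(C, D)` is a `B`-blocker of `A`: `D` is a subuniverse, `∅ ≠ C ⊆ D`, `C ∩ B = ∅`,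
`D ∩ B ≠ ∅`, and `D ^ n \ (D \ C) ^ n` is a subuniverse of `A ^ n` for every `n ≥ 1`. -/
structure IsBlocker (B : L.Substructure A) (C : Set A) (D : L.Substructure A) : Prop where
  nonempty : C.Nonempty
  subset : C ⊆ (D : Set A)
  inter_eq_empty : C ∩ (B : Set A) = ∅
  inter_nonempty : ((D : Set A) ∩ (B : Set A)).Nonempty
  isSubpower : ∀ n : ℕ, 1 ≤ n →
    IsSubpower L ({x : Fin n → A | ∀ i, x i ∈ (D : Set A)} \
      {x : Fin n → A | ∀ i, x i ∈ (D : Set A) \ C})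

end

end Absorption

/-!
That absorption implies Jónsson absorption and excludes blockers is direct: the absorbing term,
with its arguments switched from `x` to `z` one at a time, gives the Jónsson chain, and applied to
the tuples `(b, …, c, …, b)` it would lead out of a blocker.

For the converse, say that a set of tuples avoids `B` if some subpower containing it has no tuple
with all entries in `B`. Suppose that `B` Jónsson absorbs `A` but does not absorb it. The proof
produces sets of tuples that avoid `B` and are better and better structured, and ends at a blocker.

* A minimality argument and Ramsey's theorem give `a` and `b', b ∈ B` such that the tuples
  `(b', …, b', a, b, …, b)` of any length avoid `B`
  (`exists_essential_of_not_absorbs`, `exists_isBadSpike_of_not_absorbs`).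
* One can take `b' = b` (`exists_isBadSpike_diag`).
* From these, one builds cubes of all dimensions: pairs `p i`, `x i` with `x i ∈ B` such that
  the vertices of `∏ {p i, x i}` other than `x` avoid `B` (`IsBadCube.exists_option`). By the
  pigeonhole principle, all the pairs can be the same pair `a`, `b`.
* So the pair `({a}, {a, b})` has the property that, for all `n`, the tuples over `D` with an entry
  in `C` avoid `B`. A maximal pair `(C, D)` with this property is a blocker (`isSubpower_cross`).

The second and third steps are where Jónsson absorption enters, in the same way. A Jónsson
term `d` applied to tuples with a spike at the places `i < m < j` returns a tuple with spikes at `i`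
and `j` only, as `d (B, A, B) ⊆ B`. Fixing `y ∈ B`, the Jónsson chain becomes a path from the
identity to the constant `y` through the maps `x ↦ d (x, y, y)`. An argument about finite
transformation monoids (`exists_step_leaving`) provides a Jónsson term with `d (q, q, y) = q`
such that `q` belongs to a bad configuration and `d (q, y, y)` does not. The latter lets the spike
at `i` be removed; the former keeps the configuration exact.
-/

namespace Absorption

open FirstOrder FirstOrder.Language

variable {L : FirstOrder.Language.{u, v}} {A : Type w} [L.Structure A]

/-! ### Subpowers and terms -/

theorem IsIdempotentAlgebra.realize (hA : IsIdempotentAlgebra L A) {ι : Type*} (t : L.Term ι)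
    (x : A) : t.realize (fun _ => x) = x := by
  induction t with
  | var i => rfl
  | func f ts ih =>
    simp only [Term.realize_func, ih]
    exact hA _ f x

theorem IsIdempotentAlgebra.realize₂ (hA : IsIdempotentAlgebra L A) (t : L.Term (Fin 2))
    (x : A) : t.realize ![x, x] = x := by
  rw [← hA.realize t x]
  congr 1
  funext i
  fin_cases i <;> simp [hA.realize]

theorem IsIdempotentAlgebra.realize₃ (hA : IsIdempotentAlgebra L A) (t : L.Term (Fin 3))
    (x : A) : t.realize ![x, x, x] = x := by
  rw [← hA.realize t x]
  congr 1
  funext i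
  fin_cases i <;> simp [hA.realize]

theorem IsSubpower.realize_mem {J ι : Type*} {R : Set (J → A)} (hR : IsSubpower L R)
    (t : L.Term ι) (r : ι → J → A) (hr : ∀ i, r i ∈ R) :
    (fun j => t.realize (fun i => r i j)) ∈ R := by
  induction t with
  | var i => exact hr i
  | func f ts ih =>
    simp only [Term.realize_func]
    exact hR _ f (fun l j => (ts l).realize fun i => r i j) ih

theorem IsSubpower.realize₃_mem {J : Type*} {R : Set (J → A)} (hR : IsSubpower L R)
    (t : L.Term (Fin 3)) {r s q : J → A} (hr : r ∈ R) (hs : s ∈ R) (hq : q ∈ R) :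
    (fun j => t.realize ![r j, s j, q j]) ∈ R := by
  have := hR.realize_mem t ![r, s, q] (by intro i; fin_cases i <;> assumption)
  convert this using 3
  rename_i j
  funext i
  fin_cases i <;> rfl

theorem realize_mem_substructure (B : L.Substructure A) {ι : Type*} (t : L.Term ι) (r : ι → A)
    (hr : ∀ i, r i ∈ B) : t.realize r ∈ B :=
  t.realize_mem r hr

/-- The values of all terms on a family of tuples form a subpower. -/
theorem isSubpower_range_realize {J ι : Type*} (e : ι → J → A) :
    IsSubpower L (Set.range fun (t : L.Term ι) (j : J) => t.realize fun i => e i j) := by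
  intro k f r hr
  choose t ht using hr
  refine ⟨Term.func f t, ?_⟩
  funext j
  simp only [Term.realize_func, ← ht]

/-- The tuples of `G` avoid `B` on the coordinates in `T`: some subpower containing `G` has no
tuple whose coordinates in `T` all lie in `B`. -/
def Avoids (L : FirstOrder.Language.{u, v}) {A : Type w} [L.Structure A] (B : Set A) {J : Type*}
    (T : Set J) (G : Set (J → A)) : Prop :=
  ∃ R : Set (J → A), IsSubpower L R ∧ G ⊆ R ∧ ∀ r ∈ R, ∃ j ∈ T, r j ∉ B

/-- If `G` does not avoid `B`, a single tuple witnesses this in all subpowers containing `G`,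
namely one in the subpower generated by `G`. -/
theorem exists_mem_of_not_avoids {B : Set A} {J : Type*} {T : Set J} {G : Set (J → A)}
    (h : ¬ Avoids L B T G) :
    ∃ u : J → A, (∀ j ∈ T, u j ∈ B) ∧ ∀ R, IsSubpower L R → G ⊆ R → u ∈ R := by
  by_contra! hu
  refine h ⟨{r | ∀ R, IsSubpower L R → G ⊆ R → r ∈ R}, ?_, ?_, ?_⟩
  · intro k f r hr R hR hG
    exact hR k f r fun j => hr j R hR hG
  · intro g hg R _ hG
    exact hG hg
  · intro r hr
    by_contra! hT
    obtain ⟨R, hR, hG, hn⟩ := hu r hT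
    exact hn (hr R hR hG)

/-- In an idempotent algebra, a product of blocks is generated blockwise: a subpower containing
every tuple whose `i`-th block lies in `S i` contains every tuple whose `i`-th block is generated
by `S i`. -/
theorem IsSubpower.mem_of_blocks (hA : IsIdempotentAlgebra L A) {ι : Type*} [Finite ι]
    {I : ι → Type*} {R : Set ((Σ i, I i) → A)} (hR : IsSubpower L R) (S : ∀ i, Set (I i → A))
    (hS : ∀ y : ∀ i, I i → A, (∀ i, y i ∈ S i) → (fun s : Σ i, I i => y s.1 s.2) ∈ R)
    (z : ∀ i, I i → A) (hz : ∀ i, ∀ Q, IsSubpower L Q → S i ⊆ Q → z i ∈ Q) :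
    (fun s : Σ i, I i => z s.1 s.2) ∈ R := by
  classical
  have := Fintype.ofFinite ι
  suffices H : ∀ (F : Finset ι) (y : ∀ i, I i → A), (∀ i ∈ F, y i = z i) →
      (∀ i ∉ F, y i ∈ S i) → (fun s : Σ i, I i => y s.1 s.2) ∈ R from
    H Finset.univ z (fun _ _ => rfl) (fun i hi => absurd (Finset.mem_univ i) hi)
  intro F
  induction F using Finset.induction_on with
  | empty => exact fun y _ hy => hS y fun i => hy i (Finset.notMem_empty i)
  | insert i₀ F hi₀ ih =>
    intro y hy hy'
    have key : z i₀ ∈ {q : I i₀ → A |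
        (fun s : Σ i, I i => Function.update y i₀ q s.1 s.2) ∈ R} := by
      refine hz i₀ _ ?_ ?_
      · intro k f r hr
        show _ ∈ R
        convert hR k f _ hr using 1
        funext ⟨i, s⟩
        by_cases h : i = i₀
        · subst h
          simp
        · simp [h, hA k f]
      · intro q hq
        refine ih _ (fun i hi => ?_) (fun i hi => ?_)
        · have : i ≠ i₀ := fun h => hi₀ (h ▸ hi)
          simp [this, hy i (Finset.mem_insert_of_mem hi)]
        · by_cases h : i = i₀
          · subst h
            simpa using hq
          · simpa [h] using hy' i (by simp [h, hi])
    rw [← hy i₀ (Finset.mem_insert_self _ _)] at key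
    simpa using key

/-- The version of `IsSubpower.mem_of_blocks` for blocks of one coordinate. -/
theorem IsSubpower.mem_of_forall_mem_closure (hA : IsIdempotentAlgebra L A) {ι : Type*} [Finite ι]
    {R : Set (ι → A)} (hR : IsSubpower L R) (S : ι → Set A)
    (hS : ∀ y : ι → A, (∀ i, y i ∈ S i) → y ∈ R)
    (z : ι → A) (hz : ∀ i, z i ∈ Substructure.closure L (S i)) : z ∈ R := by
  have hR' : IsSubpower L {r : (Σ _ : ι, Unit) → A | (fun i => r ⟨i, ()⟩) ∈ R} :=
    fun k f r hr => hR k f (fun j i => r j ⟨i, ()⟩) hr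
  refine hR'.mem_of_blocks hA (fun i => {q | q () ∈ S i}) (fun y hy => hS _ hy)
    (fun i _ => z i) fun i Q hQ hSQ => ?_
  refine Substructure.closure_induction (p := fun a => (fun _ : Unit => a) ∈ Q) (hz i)
    (fun a ha => hSQ ha) fun {k} f x hx => ?_
  exact hQ k f (fun j _ => x j) hx

/-! ### Absorption implies Jónsson absorption and excludes blockers -/

theorem Absorbs.jonssonAbsorbs {B : L.Substructure A} (h : Absorbs B) : JonssonAbsorbs B := by
  obtain ⟨n, t, ht, hB⟩ := h
  -- `d (i + 1) (x, y, z) = t (z, …, z, y, x, …, x)`, with `y` at place `i`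
  refine ⟨n + 1, fun i => if i = 0 then Term.var 0 else if i = n + 1 then Term.var 2 else
    t.subst fun j : Fin n => Term.var
      (if (j : ℕ) + 1 < i then 2 else if (j : ℕ) + 1 = i then 1 else 0), ?_, ?_, ?_, ?_⟩
  · intro i hi b hb a b' hb'
    dsimp only
    split_ifs with h0 h1
    · exact hb
    · exact hb'
    · have hi' : i - 1 < n := by omega
      rw [Term.realize_subst]
      convert hB (fun j => if (j : ℕ) + 1 < i then b' else b)
        (fun j => by split_ifs <;> assumption) ⟨i - 1, hi'⟩ a using 2
      funext j
      rw [Function.update_apply]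
      have : j = ⟨i - 1, hi'⟩ ↔ (j : ℕ) + 1 = i := by
        rw [Fin.ext_iff]
        simp only
        omega
      simp only [this, Term.realize_var]
      split_ifs <;> first | rfl | omega
  · intro i hi x y
    have hconst : ∀ (v : Fin n → A) (c : A), (∀ j, v j = c) → t.realize v = c := by
      intro v c hv
      rw [show v = fun _ => c from funext hv, ht]
    have hi0 : ¬ i = n + 1 := by omega
    simp only [hi0, if_false, Nat.succ_ne_zero, Nat.add_right_cancel_iff]
    split_ifs with h0 h1 h1
    · -- for `n = 0` the term `t` is a constant, and `A` has at most one element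
      subst h1 h0
      exact (hconst (fun _ => x) x fun _ => rfl).symm.trans (hconst _ y fun j => j.elim0)
    · rw [Term.realize_subst, hconst _ x]
      · rfl
      · intro j
        simp only [Term.realize_var]
        split_ifs <;> first | rfl | omega
    · rw [Term.realize_subst, hconst _ y]
      · rfl
      · intro j
        have := j.2
        simp only [Term.realize_var]
        split_ifs <;> first | rfl | omega
    · rw [Term.realize_subst, Term.realize_subst]
      congr 1
      funext j
      simp only [Term.realize_var]
      split_ifs <;> first | rfl | omega
  · intro x y z
    simp
  · intro x y z
    simp

theorem Absorbs.not_isBlocker {B : L.Substructure A} (h : Absorbs B) (C : Set A)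
    (D : L.Substructure A) : ¬ IsBlocker B C D := by
  intro hCD
  obtain ⟨n, t, ht, hB⟩ := h
  obtain ⟨c, hc⟩ := hCD.nonempty
  obtain ⟨b, hbD, hbB⟩ := hCD.inter_nonempty
  have hdisj : ∀ x ∈ C, x ∉ B := fun x hx hx' => by
    have : x ∈ C ∩ (B : Set A) := ⟨hx, hx'⟩
    simp [hCD.inter_eq_empty] at this
  rcases Nat.eq_zero_or_pos n with rfl | hn
  · -- a constant idempotent term forces `c = b`
    refine hdisj c hc ?_
    rw [← ht c, show (fun _ : Fin 0 => c) = fun _ => b from funext fun i => i.elim0, ht b]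
    exact hbB
  · have hmem := (hCD.isSubpower n hn).realize_mem t
      (fun i => Function.update (fun _ => b) i c) fun i => by
        refine ⟨fun j => ?_, fun hj => (hj i).2 (by simpa using hc)⟩
        rw [Function.update_apply]
        split_ifs
        · exact hCD.subset hc
        · exact hbD
    refine hmem.2 fun j => ⟨hmem.1 j, fun hj => hdisj _ hj ?_⟩
    convert hB (fun _ => b) (fun _ => hbB) j c using 2
    funext i
    simp only [Function.update_apply, eq_comm]

/-! ### Paths in a finite transformation monoid -/

theorem exists_pow_isIdempotentElem {M : Type*} [Monoid M] [Finite M] (a : M) :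
    ∃ m, IsIdempotentElem (a ^ (m + 1)) := by
  obtain ⟨i, j, hij, h⟩ := Finite.exists_ne_map_eq_of_infinite fun n : ℕ => a ^ (n + 1)
  wlog hlt : i < j generalizing i j
  · exact this j i hij.symm h.symm (by omega)
  obtain ⟨p, rfl⟩ := Nat.exists_eq_add_of_lt hlt
  have hper : ∀ k n, i + 1 ≤ n → a ^ (n + k * (p + 1)) = a ^ n := by
    intro k
    induction k with
    | zero => simp
    | succ k ih =>
      intro n hn
      obtain ⟨q, rfl⟩ := Nat.exists_eq_add_of_le hn
      rw [← ih _ hn]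
      have e1 : i + 1 + q + (k + 1) * (p + 1) = (i + p + 1 + 1) + (q + k * (p + 1)) := by ring
      have e2 : i + 1 + q + k * (p + 1) = (i + 1) + (q + k * (p + 1)) := by ring
      rw [e1, e2, pow_add, pow_add a (i + 1)]
      rw [h]
  refine ⟨(i + 1) * (p + 1) - 1, ?_⟩
  have hpos : 0 < (i + 1) * (p + 1) := by positivity
  rw [Nat.sub_add_cancel hpos, IsIdempotentElem, ← pow_add]
  exact hper (i + 1) _ (Nat.le_mul_of_pos_right _ (by omega))

/-- Along a path of transformations from the identity to a constant map, taken in a monoid of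
transformations of a finite set and with a step relation stable under composition on both sides,
one can find a (possibly different) step `e → f` and a point `q ∈ X` fixed by `e` that `f` moves
out of `X`, whenever `X` is nonempty and does not contain the constant.

To prove it, conjugate the path by an idempotent with a fixed point in `X` and of least range. The
last map on the conjugated path that keeps the fixed points inside `X` then acts invertibly on the
range of the idempotent, so the step leaving it can be translated to a step leaving the
idempotent. -/
theorem exists_step_leaving {α : Type*} [Finite α] (M : Submonoid (Function.End α))
    (E : Function.End α → Function.End α → Prop)
    (hl : ∀ s ∈ M, ∀ f f', E f f' → E (s * f) (s * f'))
    (hr : ∀ s ∈ M, ∀ f f', E f f' → E (f * s) (f' * s))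
    (y : α) (hy : ∀ s ∈ M, s y = y) (n : ℕ) (g : ℕ → Function.End α) (g_zero : g 0 = 1)
    (g_last : ∀ x, g n x = y) (hgM : ∀ k ≤ n, g k ∈ M) (hgE : ∀ k < n, E (g k) (g (k + 1)))
    (X : Set α) (hX : X.Nonempty) (hyX : y ∉ X) :
    ∃ e f : Function.End α, E e f ∧ ∃ q ∈ X, e q = q ∧ f q ∉ X := by
  classical
  have : Finite (Function.End α) := inferInstanceAs (Finite (α → α))
  by_contra! H
  obtain ⟨e, ⟨heM, hee, x₀, hx₀, hex₀⟩, hmin⟩ := Set.exists_min_image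
    {e : Function.End α | e ∈ M ∧ e * e = e ∧ ∃ x ∈ X, e x = x}
    (fun e => (Set.range e).ncard) (Set.toFinite _)
    (hX.elim fun x hx => ⟨1, M.one_mem, one_mul 1, x, hx, rfl⟩)
  set h : ℕ → Function.End α := fun k => e * g k * e with hdef
  have heh : ∀ k, e * h k = h k := fun k => by simp only [hdef, ← mul_assoc, hee]
  have hhe : ∀ k, h k * e = h k := fun k => by simp only [hdef, mul_assoc, hee]
  have hex : ∃ k, ¬ ∀ q ∈ X, e q = q → h k q ∈ X := by
    refine ⟨n, fun hn => hyX ?_⟩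
    have := hn x₀ hx₀ hex₀
    rwa [show h n x₀ = e (g n (e x₀)) from rfl, g_last, hy e heM] at this
  obtain ⟨k, hk⟩ : ∃ k, Nat.find hex = k + 1 := by
    refine Nat.exists_eq_succ_of_ne_zero fun h0 => ?_
    have := Nat.find_spec hex
    rw [h0] at this
    refine this fun q hq heq => ?_
    rw [show h 0 = e by simp [hdef, g_zero, hee], heq]
    exact hq
  have hkX : ∀ q ∈ X, e q = q → h k q ∈ X :=
    not_not.1 (Nat.find_min hex (by omega : k < Nat.find hex))
  have hk1 := Nat.find_spec hex
  rw [hk] at hk1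
  have hkn : k < n := by
    have : Nat.find hex ≤ n := Nat.find_min' hex fun hn => hyX (by
      have := hn x₀ hx₀ hex₀
      rwa [show h n x₀ = e (g n (e x₀)) from rfl, g_last, hy e heM] at this)
    omega
  set σ := h k with hσ
  have hσM : σ ∈ M := M.mul_mem (M.mul_mem heM (hgM k hkn.le)) heM
  obtain ⟨m, hm⟩ := exists_pow_isIdempotentElem σ
  have hστ : ∀ j, ∀ q ∈ X, e q = q → (σ ^ j) q ∈ X ∧ e ((σ ^ j) q) = (σ ^ j) q := by
    intro j
    induction j with
    | zero => exact fun q hq heq => ⟨hq, heq⟩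
    | succ j ih =>
      intro q hq heq
      obtain ⟨h1, h2⟩ := ih q hq heq
      rw [pow_succ']
      exact ⟨hkX _ h1 h2, congrFun (heh k) _⟩
  have hmin' := hmin (σ ^ (m + 1)) ⟨M.pow_mem hσM _, hm, _, (hστ (m + 1) x₀ hx₀ hex₀).1,
    congrFun hm x₀⟩
  have hsub : Set.range (σ ^ (m + 1)) ⊆ Set.range e := by
    rintro _ ⟨x, rfl⟩
    have : σ ^ (m + 1) = e * σ ^ (m + 1) := by rw [pow_succ', ← mul_assoc, heh]
    rw [this]
    exact ⟨_, rfl⟩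
  have hrange := Set.eq_of_subset_of_ncard_le hsub hmin' (Set.toFinite _)
  have hpow : σ ^ (m + 1) = e := by
    funext x
    obtain ⟨z, hz⟩ : e x ∈ Set.range (σ ^ (m + 1)) := hrange ▸ ⟨x, rfl⟩
    have h1 : (σ ^ (m + 1)) (e x) = e x := by
      rw [← hz]
      exact congrFun hm z
    have h2 : σ ^ (m + 1) * e = σ ^ (m + 1) := by rw [pow_succ, mul_assoc, hhe]
    rw [← h1]
    exact (congrFun h2 x).symm
  have hstep : E e (σ ^ m * h (k + 1)) := by
    have := hl _ (M.mul_mem (M.pow_mem hσM m) heM) _ _ (hr e heM _ _ (hgE k hkn))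
    convert this using 1
    · rw [mul_assoc, ← mul_assoc e]
      exact hpow.symm.trans (pow_succ σ m)
    · rw [mul_assoc, ← mul_assoc e]
  refine hk1 fun q hq heq => ?_
  have hq' := H _ _ hstep q hq heq
  have hcomm : e * σ ^ m = σ ^ m * e := by
    have : Commute e σ := show e * σ = σ * e by rw [heh, hhe]
    exact (this.pow_right m).eq
  have hfix : e ((σ ^ m * h (k + 1)) q) = (σ ^ m * h (k + 1)) q := by
    have : e * (σ ^ m * h (k + 1)) = σ ^ m * h (k + 1) := by
      rw [← mul_assoc, hcomm, mul_assoc, heh]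
    exact congrFun this q
  have := hkX _ hq' hfix
  rwa [show σ ((σ ^ m * h (k + 1)) q) = (σ * (σ ^ m * h (k + 1))) q from rfl, ← mul_assoc,
    ← pow_succ', hpow, heh] at this

/-! ### Essential families of tuples -/

/-- Failure of absorption in every arity yields essential families of tuples of every length `N`:
the `i`-th tuple is in `B` off the coordinate `i`, and no term maps the family into `B`. They are
found on a minimal set of rows `(b, a at i)` that no `N`-ary term maps into `B`. -/
theorem exists_essential_of_not_absorbs [Finite A] (hA : IsIdempotentAlgebra L A)
    {B : L.Substructure A} (h : ¬ Absorbs B) (N : ℕ) :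
    ∃ e : Fin N → Fin N → A, (∀ i j, i ≠ j → e i j ∈ B) ∧
      Avoids L (B : Set A) Set.univ (Set.range e) := by
  classical
  by_contra! hN
  have := Fintype.ofFinite A
  have hits : ∀ e : Fin N → Fin N → A, (∀ i j, i ≠ j → e i j ∈ B) →
      ∃ s : L.Term (Fin N), ∀ j, s.realize (fun i => e i j) ∈ B := by
    intro e he
    by_contra! hs
    refine hN e he ⟨_, isSubpower_range_realize e, ?_, ?_⟩
    · rintro _ ⟨i, rfl⟩
      exact ⟨Term.var i, rfl⟩
    · rintro _ ⟨s, rfl⟩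
      obtain ⟨j, hj⟩ := hs s
      exact ⟨j, Set.mem_univ j, hj⟩
  let row : Fin N × {b : Fin N → A // ∀ j, b j ∈ B} × A → Fin N → A :=
    fun ρ => Function.update ρ.2.1.1 ρ.1 ρ.2.2
  let P : Finset (Fin N × {b : Fin N → A // ∀ j, b j ∈ B} × A) → Prop :=
    fun J => ∀ t : L.Term (Fin N), ∃ ρ ∈ J, t.realize (row ρ) ∉ B
  have hP : P Finset.univ := by
    intro t
    by_contra! ht
    exact h ⟨N, t, hA.realize t, fun b hb i a => ht (i, ⟨b, hb⟩, a) (Finset.mem_univ _)⟩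
  obtain ⟨J, -, hJ, hmin⟩ : ∃ J, J ≤ Finset.univ ∧ P J ∧ ∀ J', P J' → J' ≤ J → J ≤ J' := by
    obtain ⟨J, h1, h2⟩ := exists_minimal_le_of_wellFoundedLT P Finset.univ hP
    exact ⟨J, h1, h2.1, fun J' hJ' hle => h2.2 hJ' hle⟩
  have hρ : ∀ i, ∃ ρ ∈ J, ρ.1 = i := by
    intro i
    obtain ⟨ρ, hρJ, hρ⟩ := hJ (Term.var i)
    refine ⟨ρ, hρJ, ?_⟩
    by_contra hne
    refine hρ ?_
    simpa [row, Function.update_of_ne (Ne.symm hne)] using ρ.2.1.2 i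
  choose ρ hρJ hρi using hρ
  have ht : ∀ i, ∃ t : L.Term (Fin N), ∀ r ∈ J, r ≠ ρ i → t.realize (row r) ∈ B := by
    intro i
    by_contra! ht
    have : P (J.erase (ρ i)) := fun t => by
      obtain ⟨r, hr, hne, hrt⟩ := ht t
      exact ⟨r, Finset.mem_erase.2 ⟨hne, hr⟩, hrt⟩
    exact Finset.notMem_erase _ _ (hmin _ this (Finset.erase_subset _ _) (hρJ i))
  choose t ht using ht
  obtain ⟨s, hs⟩ := hits (fun i j => (t i).realize (row (ρ j))) fun i j hij =>
    ht i _ (hρJ j) fun h => hij (by rw [← hρi i, ← hρi j, h])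
  obtain ⟨r, hrJ, hr⟩ := hJ (s.subst t)
  rw [Term.realize_subst] at hr
  by_cases hex : ∃ j, r = ρ j
  · obtain ⟨j, rfl⟩ := hex
    exact hr (hs j)
  · push Not at hex
    exact hr (realize_mem_substructure B s _ fun i => ht i r hrJ (hex i))

/-- The sequence with value `b'` before the place `i`, `a` at `i`, and `b` after `i`. -/
def spike (b' a b : A) (i : ℕ) : ℕ → A :=
  fun n => if n < i then b' else if n = i then a else b

/-- For every `N`, the sequences with spike `a` at a place `i < N`, equal to `b'` on the left of
the spike and to `b` on its right, avoid `B` on the first `N` coordinates. -/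
def IsBadSpike (L : FirstOrder.Language.{u, v}) {A : Type w} [L.Structure A] (B : Set A)
    (b' a b : A) : Prop :=
  ∀ N : ℕ, Avoids L B (Set.Iio N) (spike b' a b '' Set.Iio N)

/-- Ramsey's theorem for ordered pairs, in terms of a finite colouring of `ℕ × ℕ`. -/
theorem exists_homogeneous {α : Type*} [Finite α] (c : ℕ → ℕ → α) :
    ∃ b' a b : α, ∀ N, ∃ φ : ℕ → ℕ, StrictMonoOn φ (Set.Iio N) ∧
      ∀ i < N, ∀ j < N, c (φ i) (φ j) = spike b' a b i j := by
  classical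
  let U : Ultrafilter ℕ := Filter.hyperfilter ℕ
  have lim : ∀ f : ℕ → α, ∃ x, ∀ᶠ n in (U : Filter ℕ), f n = x := fun f => by
    have := (Ultrafilter.eventually_exists_iff (f := U) (P := fun x n => f n = x)).1
      (Filter.Eventually.of_forall fun n => ⟨f n, rfl⟩)
    exact this
  choose right hright using fun i => lim fun j => c i j
  choose left hleft using fun i => lim fun j => c j i
  obtain ⟨b, hb⟩ := lim right
  obtain ⟨b', hb'⟩ := lim left
  obtain ⟨a, ha⟩ := lim fun i => c i i
  refine ⟨b', a, b, fun N => ?_⟩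
  -- the places are chosen one after the other, within the sets given by the limits
  suffices H : ∃ φ : ℕ → ℕ, StrictMonoOn φ (Set.Iio N) ∧
      (∀ i < N, right (φ i) = b ∧ left (φ i) = b') ∧
      ∀ i < N, ∀ j < N, c (φ i) (φ j) = spike b' a b i j from
    H.imp fun φ hφ => ⟨hφ.1, hφ.2.2⟩
  induction N with
  | zero => exact ⟨id, fun i hi => absurd hi (Nat.not_lt_zero i), by simp, by simp⟩
  | succ N ih =>
    obtain ⟨φ, hφ, hlim, hc⟩ := ih
    have hfin : ∀ᶠ n in (U : Filter ℕ), ∀ i ∈ Finset.range N,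
        c (φ i) n = right (φ i) ∧ c n (φ i) = left (φ i) ∧ φ i < n := by
      rw [Filter.eventually_all_finset]
      intro i _
      have hgt : ∀ᶠ n in (U : Filter ℕ), φ i < n :=
        Nat.hyperfilter_le_atTop (Filter.eventually_gt_atTop (φ i))
      exact (hright _).and ((hleft _).and hgt)
    obtain ⟨m, hm, hmb, hmb', hma⟩ := (hfin.and (hb.and (hb'.and ha))).exists
    simp only [Finset.mem_range] at hm
    refine ⟨Function.update φ N m, ?_, ?_, ?_⟩
    · intro i hi j hj hij
      simp only [Set.mem_Iio] at hi hj
      have hiN : i < N := by omega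
      rcases Nat.lt_succ_iff_lt_or_eq.1 hj with hjN | rfl
      · simpa [Function.update_of_ne, hiN.ne, hjN.ne] using hφ hiN hjN hij
      · simpa [Function.update_of_ne, hiN.ne] using (hm i hiN).2.2
    · intro i hi
      rcases Nat.lt_succ_iff_lt_or_eq.1 hi with hiN | rfl
      · simpa [Function.update_of_ne, hiN.ne] using hlim i hiN
      · simpa using ⟨hmb, hmb'⟩
    · intro i hi j hj
      rcases Nat.lt_succ_iff_lt_or_eq.1 hi with hiN | rfl <;>
        rcases Nat.lt_succ_iff_lt_or_eq.1 hj with hjN | rfl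
      · simpa [Function.update_of_ne, hiN.ne, hjN.ne] using hc i hiN j hjN
      · simp [Function.update_of_ne, hiN.ne, spike, hiN.not_gt, hiN.ne', (hm i hiN).1, hlim i hiN]
      · simp [Function.update_of_ne, hjN.ne, spike, hjN, (hm j hjN).2.1, hlim j hjN]
      · simpa [spike] using hma

/-- A compactness and Ramsey argument turns essential families into spikes. -/
theorem exists_isBadSpike_of_not_absorbs [Finite A] (hA : IsIdempotentAlgebra L A)
    {B : L.Substructure A} (h : ¬ Absorbs B) :
    ∃ b' ∈ B, ∃ b ∈ B, ∃ a, IsBadSpike L (B : Set A) b' a b := by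
  classical
  obtain ⟨a₀⟩ : Nonempty A := by
    obtain ⟨e, -, R, -, hR, hn⟩ := exists_essential_of_not_absorbs hA h 1
    exact ⟨e 0 0⟩
  choose e heB he using exists_essential_of_not_absorbs hA h
  let U : Ultrafilter ℕ := Filter.hyperfilter ℕ
  have hlim : ∀ i j : ℕ, ∃ x, ∀ᶠ M in (U : Filter ℕ),
      ∃ (hi : i < M) (hj : j < M), e M ⟨i, hi⟩ ⟨j, hj⟩ = x := fun i j => by
    refine (Ultrafilter.eventually_exists_iff (f := U)
      (P := fun x M => ∃ (hi : i < M) (hj : j < M), e M ⟨i, hi⟩ ⟨j, hj⟩ = x)).1 ?_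
    have h1 : ∀ᶠ M in (U : Filter ℕ), i < M :=
      Nat.hyperfilter_le_atTop (Filter.eventually_gt_atTop i)
    have h2 : ∀ᶠ M in (U : Filter ℕ), j < M :=
      Nat.hyperfilter_le_atTop (Filter.eventually_gt_atTop j)
    filter_upwards [h1, h2] with M hi hj
    exact ⟨_, hi, hj, rfl⟩
  choose c hc using hlim
  have hcB : ∀ i j, i ≠ j → c i j ∈ B := fun i j hij => by
    obtain ⟨M, hi, hj, hM⟩ := (hc i j).exists
    rw [← hM]
    exact heB M _ _ fun h => hij (Fin.mk.inj_iff.1 h)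
  obtain ⟨b', a, b, hhom⟩ := exists_homogeneous c
  obtain ⟨φ, hφ, h2⟩ := hhom 2
  have hne : φ 0 ≠ φ 1 := (hφ (by simp) (by simp) zero_lt_one).ne
  refine ⟨b', ?_, b, ?_, a, fun N => ?_⟩
  · have := h2 1 (by simp) 0 (by simp)
    simp only [spike, zero_lt_one, if_true] at this
    exact this ▸ hcB _ _ hne.symm
  · have := h2 0 (by simp) 1 (by simp)
    simp [spike] at this
    exact this ▸ hcB _ _ hne
  · obtain ⟨φ, hφ, hφc⟩ := hhom N
    have hev : ∀ᶠ M in (U : Filter ℕ), ∀ i ∈ Finset.range N, ∀ j ∈ Finset.range N,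
        ∃ (hi : φ i < M) (hj : φ j < M), e M ⟨φ i, hi⟩ ⟨φ j, hj⟩ = c (φ i) (φ j) := by
      simp only [Filter.eventually_all_finset]
      exact fun i _ j _ => hc _ _
    obtain ⟨M, hM⟩ := hev.exists
    simp only [Finset.mem_range] at hM
    have hφM : ∀ i < N, φ i < M := fun i hi => (hM i hi i hi).1
    obtain ⟨R, hR, hG, hav⟩ := he M
    refine ⟨{r | ∃ q ∈ R, (∀ (k) (hk : k < N), r k = q ⟨φ k, hφM k hk⟩) ∧
      ∀ j : Fin M, (∀ k < N, φ k ≠ j) → q j ∈ B}, ?_, ?_, ?_⟩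
    · intro k f r hr
      choose q hqR hq hqB using hr
      refine ⟨_, hR k f q hqR, fun n hn => ?_, fun j hj => B.fun_mem f _ fun l => hqB l j hj⟩
      simp only [hq _ n hn]
    · rintro _ ⟨i, hi, rfl⟩
      refine ⟨e M ⟨φ i, hφM i hi⟩, hG ⟨_, rfl⟩, fun k hk => ?_, fun j hj => ?_⟩
      · rw [← hφc i hi k hk]
        exact (hM i hi k hk).2.2.symm
      · exact heB M _ _ fun h => hj i hi (by rw [← h])
    · rintro r ⟨q, hqR, hrq, hqB⟩
      obtain ⟨j, -, hj⟩ := hav q hqR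
      by_cases hex : ∃ k, k < N ∧ φ k = j
      · obtain ⟨k, hk, hkj⟩ := hex
        refine ⟨k, hk, ?_⟩
        rw [hrq k hk, show (⟨φ k, hφM k hk⟩ : Fin M) = j from Fin.ext hkj]
        exact hj
      · push Not at hex
        exact absurd (hqB j hex) hj

/-! ### Jónsson absorption and transformations of the algebra -/

/-- The monoid of all maps `x ↦ s (x, y)`, for a binary term `s`. -/
def termMaps (L : FirstOrder.Language.{u, v}) {A : Type w} [L.Structure A] (y : A) :
    Submonoid (Function.End A) where
  carrier := {f | ∃ s : L.Term (Fin 2), ∀ x, f x = s.realize ![x, y]}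
  one_mem' := ⟨Term.var 0, fun _ => rfl⟩
  mul_mem' := by
    rintro f g ⟨s, hs⟩ ⟨t, ht⟩
    refine ⟨s.subst ![t, Term.var 1], fun x => ?_⟩
    rw [Term.realize_subst]
    show f (g x) = _
    rw [hs, ht]
    congr 1
    funext i
    fin_cases i <;> rfl

/-- There is a ternary term `d` with `d (B, A, B) ⊆ B`, `d (x, x, y) = f x` and
`d (x, y, y) = f' x`. -/
def JonssonStep (B : L.Substructure A) (y : A) (f f' : Function.End A) : Prop :=
  ∃ d : L.Term (Fin 3), (∀ b ∈ B, ∀ a, ∀ b' ∈ B, d.realize ![b, a, b'] ∈ B) ∧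
    (∀ x, d.realize ![x, x, y] = f x) ∧ ∀ x, d.realize ![x, y, y] = f' x

theorem JonssonStep.mul_left {B : L.Substructure A} {y : A} {f f' s : Function.End A}
    (h : JonssonStep B y f f') (hs : s ∈ termMaps L y) : JonssonStep B y (s * f) (s * f') := by
  obtain ⟨d, hd, h1, h2⟩ := h
  obtain ⟨s', hs'⟩ := hs
  have key : ∀ x z u : A, (s'.subst ![d, Term.var 2]).realize ![x, z, u] =
      s'.realize ![d.realize ![x, z, u], u] := fun x z u => by
    rw [Term.realize_subst]
    congr 1
    funext i
    fin_cases i <;> rfl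
  refine ⟨s'.subst ![d, Term.var 2], fun b hb a b' hb' => ?_, fun x => ?_, fun x => ?_⟩
  · rw [key]
    refine realize_mem_substructure B _ _ fun i => ?_
    fin_cases i
    · exact hd b hb a b' hb'
    · exact hb'
  · rw [key, h1, ← hs']
    rfl
  · rw [key, h2, ← hs']
    rfl

theorem JonssonStep.mul_right (hA : IsIdempotentAlgebra L A) {B : L.Substructure A} {y : A}
    {f f' s : Function.End A} (h : JonssonStep B y f f') (hs : s ∈ termMaps L y) :
    JonssonStep B y (f * s) (f' * s) := by
  obtain ⟨d, hd, h1, h2⟩ := h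
  obtain ⟨s', hs'⟩ := hs
  set d' : L.Term (Fin 3) := d.subst ![s'.subst ![Term.var 0, Term.var 2],
    s'.subst ![Term.var 1, Term.var 2], Term.var 2] with hd'
  have key : ∀ x z u : A, d'.realize ![x, z, u] =
      d.realize ![s'.realize ![x, u], s'.realize ![z, u], u] := fun x z u => by
    rw [hd', Term.realize_subst]
    congr 1
    funext i
    fin_cases i
    · show (s'.subst _).realize _ = _
      rw [Term.realize_subst]
      congr 1
      funext i
      fin_cases i <;> rfl
    · show (s'.subst _).realize _ = _
      rw [Term.realize_subst]
      congr 1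
      funext i
      fin_cases i <;> rfl
    · rfl
  refine ⟨d', fun b hb a b' hb' => ?_, fun x => ?_, fun x => ?_⟩
  · rw [key]
    refine hd _ (realize_mem_substructure B _ _ fun i => ?_) _ _ hb'
    fin_cases i <;> assumption
  · rw [key, ← hs', h1]
    rfl
  · rw [key, ← hs', hA.realize₂, h2]
    rfl

/-- Under Jónsson absorption, a nonempty set `X` that omits `y ∈ B` is left by some Jónsson step
`d (x, x, y) → d (x, y, y)`, at a point `q` with `d (q, q, y) = q`. -/
theorem JonssonAbsorbs.exists_term_leaving [Finite A] (hA : IsIdempotentAlgebra L A)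
    {B : L.Substructure A} (h : JonssonAbsorbs B) (y : A) (X : Set A) (hX : X.Nonempty)
    (hyX : y ∉ X) :
    ∃ d : L.Term (Fin 3), (∀ b ∈ B, ∀ a, ∀ b' ∈ B, d.realize ![b, a, b'] ∈ B) ∧
      ∃ q ∈ X, d.realize ![q, q, y] = q ∧ d.realize ![q, y, y] ∉ X := by
  obtain ⟨n, d, hdB, hd, hd0, hdn⟩ := h
  obtain ⟨e, f, ⟨d, hdB, hde, hdf⟩, q, hq, heq, hfq⟩ := exists_step_leaving (termMaps L y)
    (JonssonStep B y) (fun s hs f f' h => h.mul_left hs) (fun s hs f f' h => h.mul_right hA hs) y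
    (fun s ⟨s', hs'⟩ => by rw [hs', hA.realize₂]) n (fun k x => (d k).realize ![x, y, y])
    (funext fun x => hd0 x y y) (fun x => hdn x y y)
    (fun k _ => ⟨(d k).subst ![Term.var 0, Term.var 1, Term.var 1], fun x => by
      rw [Term.realize_subst]
      refine congrArg (fun v => (d k).realize v) (funext fun i => ?_)
      fin_cases i <;> rfl⟩)
    (fun k hk => ⟨d (k + 1), hdB (k + 1) hk, fun x => (hd k hk x y).symm, fun x => rfl⟩) X hX hyX
  exact ⟨d, hdB, q, hq, (hde q).trans heq, (hdf q).symm ▸ hfq⟩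

/-- Spikes can be taken with the same value on both sides. If the pair `(b', x)` has a bad spike
and `d` is a Jónsson term with `d (x, x, b') = x` such that `(b', d (x, b', b'))` has none, then
applying `d` to three spikes gives sequences with two spikes, separating the values `b'`,
`d (x, b', b')` and `x, x`; the first spike can be removed. -/
theorem exists_isBadSpike_diag [Finite A] (hA : IsIdempotentAlgebra L A) {B : L.Substructure A}
    (hJ : JonssonAbsorbs B) {y x₀ a₀ : A} (hy : y ∈ B) (hx₀ : x₀ ∈ B)
    (h : IsBadSpike L (B : Set A) y a₀ x₀) :
    ∃ b ∈ B, ∃ a, IsBadSpike L (B : Set A) b a b := by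
  classical
  by_cases hyX : y ∈ {x | x ∈ B ∧ ∃ a, IsBadSpike L (B : Set A) y a x}
  · exact ⟨y, hy, hyX.2⟩
  obtain ⟨d, hdB, x, ⟨hx, a, ha⟩, hdx, hw⟩ :=
    hJ.exists_term_leaving hA y {x | x ∈ B ∧ ∃ a, IsBadSpike L (B : Set A) y a x}
      ⟨x₀, hx₀, a₀, h⟩ hyX
  have hw' : ¬ IsBadSpike L (B : Set A) y (d.realize ![a, y, y]) (d.realize ![x, y, y]) :=
    fun hw' => hw ⟨hdB x hx y y hy, _, hw'⟩
  simp only [IsBadSpike, not_forall] at hw'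
  obtain ⟨N₀, hN₀⟩ := hw'
  obtain ⟨u, huB, hu⟩ := exists_mem_of_not_avoids hN₀
  refine ⟨x, hx, d.realize ![x, x, a], fun N => ?_⟩
  obtain ⟨R, hR, hG, hav⟩ := ha (N₀ + 1 + N)
  refine ⟨{r | ∃ q ∈ R, (∀ n, r n = q (N₀ + 1 + n)) ∧ ∀ n ≤ N₀, q n ∈ B}, ?_, ?_, ?_⟩
  · intro k f r hr
    choose q hqR hq hqB using hr
    refine ⟨_, hR k f q hqR, fun n => ?_, fun j hj => B.fun_mem f _ fun l => hqB l j hj⟩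
    simp only [hq]
  · rintro _ ⟨j, hj, rfl⟩
    have hkill := hu {v | ∃ q ∈ R, (∀ n < N₀, v n = q n) ∧ q N₀ ∈ B ∧
        ∀ n, q (N₀ + 1 + n) = spike x (d.realize ![x, x, a]) x j n} ?_ ?_
    · obtain ⟨q, hqR, hq, hqN₀, hqs⟩ := hkill
      refine ⟨q, hqR, fun n => (hqs n).symm, fun n hn => ?_⟩
      rcases hn.lt_or_eq with hn | rfl
      · exact hq n hn ▸ huB n hn
      · exact hqN₀
    · intro k f r hr
      choose q hqR hq hqN₀ hqs using hr
      refine ⟨_, hR k f q hqR, fun n hn => ?_, B.fun_mem f _ hqN₀, fun n => ?_⟩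
      · simp only [hq _ n hn]
      · simp only [hqs, hA k f]
    · rintro _ ⟨i, hi, rfl⟩
      simp only [Set.mem_Iio] at hi hj
      refine ⟨_, hR.realize₃_mem d (hG ⟨i, ?_, rfl⟩) (hG ⟨N₀, ?_, rfl⟩)
        (hG ⟨N₀ + 1 + j, ?_, rfl⟩), fun n hn => ?_, ?_, fun n => ?_⟩
      · simp only [Set.mem_Iio]; omega
      · simp only [Set.mem_Iio]; omega
      · simp only [Set.mem_Iio]; omega
      · have h1 : n < N₀ + 1 + j := by omega
        simp only [spike, hn, h1, if_true]
        split_ifs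
        · exact (hA.realize₃ d y).symm
        · rfl
        · rfl
      · have h1 : ¬ N₀ < i := by omega
        have h2 : N₀ ≠ i := by omega
        have h3 : N₀ < N₀ + 1 + j := by omega
        simpa only [spike, h1, h2, h3, lt_irrefl, if_true, if_false] using hdB x hx a y hy
      · have h1 : ¬ N₀ + 1 + n < i := by omega
        have h2 : N₀ + 1 + n ≠ i := by omega
        have h3 : ¬ N₀ + 1 + n < N₀ := by omega
        have h4 : N₀ + 1 + n ≠ N₀ := by omega
        simp only [spike, h1, h2, h3, h4, if_false, Nat.add_lt_add_iff_left, Nat.add_left_cancel_iff]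
        split_ifs
        · exact hdx
        · rfl
        · exact hA.realize₃ d x
  · rintro r ⟨q, hqR, hrq, hqB⟩
    obtain ⟨n, hn, hnB⟩ := hav q hqR
    have hlt : N₀ < n := by
      by_contra hle
      exact hnB (hqB n (by omega))
    refine ⟨n - (N₀ + 1), ?_, ?_⟩
    · simp only [Set.mem_Iio] at hn ⊢
      omega
    · rw [hrq, show N₀ + 1 + (n - (N₀ + 1)) = n by omega]
      exact hnB

/-! ### From spikes to cubes -/

/-- The vertices of the cube spanned by the tuples `p` and `x`. -/
def cube {ι : Type*} (p x : ι → A) : Set (ι → A) := {ε | ∀ i, ε i = p i ∨ ε i = x i}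

/-- The vertices of the cube spanned by `p` and `x` that agree with `p` somewhere: all vertices
but `x`, if `p i ≠ x i` for all `i`. -/
def puncturedCube {ι : Type*} (p x : ι → A) : Set (ι → A) := {ε | ε ∈ cube p x ∧ ∃ i, ε i = p i}

/-- The tuples, on the coordinates `ι ⊕ ℕ`, made of a vertex of a cube followed by a sequence that
is constantly `b` but for a spike `q` at a place below `N`, together with the vertices of the
punctured cube followed by the constant sequence `b`. -/
def cubeSpikes {ι : Type} (p x : ι → A) (b q : A) (N : ℕ) : Set (ι ⊕ ℕ → A) :=
  {r | ∃ ε ∈ cube p x, ∃ i < N, r = Sum.elim ε (spike b q b i)} ∪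
    {r | ∃ ε ∈ puncturedCube p x, r = Sum.elim ε (fun _ => b)}

/-- For every `N`, the tuples `cubeSpikes p x b q N` avoid `B` on `ι` and the first `N` of the
coordinates in `ℕ`. -/
def IsBadCube (L : FirstOrder.Language.{u, v}) {A : Type w} [L.Structure A] (B : Set A)
    {ι : Type} (p x : ι → A) (b q : A) : Prop :=
  ∀ N : ℕ, Avoids L B {s : ι ⊕ ℕ | ∀ n, s = Sum.inr n → n < N} (cubeSpikes p x b q N)

theorem IsBadSpike.isBadCube {B : Set A} {b q : A} (h : IsBadSpike L B b q b)
    (p x : Empty → A) : IsBadCube L B p x b q := by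
  intro N
  obtain ⟨R, hR, hG, hav⟩ := h N
  refine ⟨{r | (fun n => r (Sum.inr n)) ∈ R}, fun k f r hr => hR k f _ hr, ?_, ?_⟩
  · rintro _ (⟨ε, -, i, hi, rfl⟩ | ⟨ε, ⟨-, i, -⟩, rfl⟩)
    · exact hG ⟨i, hi, rfl⟩
    · exact i.elim
  · intro r hr
    obtain ⟨n, hn, hnB⟩ := hav _ hr
    exact ⟨Sum.inr n, fun m hm => Sum.inr.inj hm ▸ hn, hnB⟩

theorem not_isBadCube_self {B : Set A} {ι : Type} {p x : ι → A} {b : A} (hx : ∀ i, x i ∈ B)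
    (hb : b ∈ B) : ¬ IsBadCube L B p x b b := by
  intro h
  obtain ⟨R, -, hG, hav⟩ := h 1
  obtain ⟨s, -, hs⟩ := hav _ (hG (Or.inl ⟨x, fun i => Or.inr rfl, 0, zero_lt_one, rfl⟩))
  refine hs ?_
  rcases s with i | n
  · exact hx i
  · simpa [spike] using hb

/-- A subpower containing a cube contains the cubes obtained by moving the corner `x` within the
subuniverses generated by the edges. -/
theorem cube_subset_of_mem_closure (hA : IsIdempotentAlgebra L A) {ι : Type*} [Finite ι]
    {T : Set (ι → A)} (hT : IsSubpower L T) {p x β : ι → A} (h : cube p x ⊆ T)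
    (hβ : ∀ i, β i ∈ Substructure.closure L {p i, x i}) : cube p β ⊆ T := by
  intro ε hε
  refine hT.mem_of_forall_mem_closure hA (fun i => {p i, x i}) (fun y hy => h hy) ε fun i => ?_
  rcases hε i with hi | hi <;> rw [hi]
  · exact Substructure.subset_closure (by simp)
  · exact hβ i

theorem puncturedCube_subset_of_mem_closure (hA : IsIdempotentAlgebra L A) {ι : Type*} [Finite ι]
    {T : Set (ι → A)} (hT : IsSubpower L T) {p x β : ι → A} (h : puncturedCube p x ⊆ T)
    (hβ : ∀ i, β i ∈ Substructure.closure L {p i, x i}) : puncturedCube p β ⊆ T := by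
  classical
  rintro ε ⟨hε, i₀, hi₀⟩
  refine hT.mem_of_forall_mem_closure hA (fun i => if i = i₀ then {p i} else {p i, x i})
    (fun y hy => h ⟨fun i => ?_, i₀, by simpa using hy i₀⟩) ε fun i => ?_
  · have := hy i
    split_ifs at this with hi
    · exact Or.inl this
    · exact this
  · split_ifs with hi
    · subst hi
      rw [hi₀]
      exact Substructure.subset_closure rfl
    · rcases hε i with hi | hi <;> rw [hi]
      · exact Substructure.subset_closure (by simp)
      · exact hβ i

/-- A bad cube with spikes yields one of the next dimension. A Jónsson term `d` with
`d (q, q, b) = q` such that `d (q, b, b)` is not a bad spike produces tuples with a spike `q` at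
one place and a spike `l = d (b, b, q)` at another, hence a new cube coordinate with vertices `q`
and `b`. The tuples with the spike `l` only, and the new corner `β` in place of `x`, come from
removing the spikes `d (q, b, b)`. -/
theorem IsBadCube.exists_option [Finite A] (hA : IsIdempotentAlgebra L A) {B : L.Substructure A}
    (hJ : JonssonAbsorbs B) {ι : Type} [Finite ι] {p x : ι → A} {b q₀ : A} (hx : ∀ i, x i ∈ B)
    (hb : b ∈ B) (h : IsBadCube L (B : Set A) p x b q₀) :
    ∃ (p' x' : Option ι → A) (q' : A), (∀ i, x' i ∈ B) ∧ IsBadCube L (B : Set A) p' x' b q' := by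
  classical
  obtain ⟨d, hdB, q, hq, hdq, hw⟩ := hJ.exists_term_leaving hA b
    {q | IsBadCube L (B : Set A) p x b q} ⟨q₀, h⟩ (not_isBadCube_self hx hb)
  have hw' : ¬ IsBadCube L (B : Set A) p x b (d.realize ![q, b, b]) := hw
  simp only [IsBadCube, not_forall] at hw'
  obtain ⟨N₀, hN₀⟩ := hw'
  obtain ⟨u, huB, hu⟩ := exists_mem_of_not_avoids hN₀
  set β : ι → A := fun i => u (Sum.inl i) with hβ
  set l : A := d.realize ![b, b, q] with hl
  have hβB : ∀ i, β i ∈ B := fun i => huB (Sum.inl i) (by simp)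
  have hβcl : ∀ i, β i ∈ Substructure.closure L {p i, x i} := by
    intro i
    refine hu {r | r (Sum.inl i) ∈ Substructure.closure L {p i, x i}}
      (fun k f r hr => (Substructure.closure L {p i, x i}).fun_mem f _ hr) ?_
    rintro _ (⟨ε, hε, j, hj, rfl⟩ | ⟨ε, ⟨hε, -⟩, rfl⟩) <;>
      exact Substructure.subset_closure (hε i)
  refine ⟨fun o => o.elim q p, fun o => o.elim b β, l, ?_, fun N => ?_⟩
  · rintro (_ | i)
    · exact hb
    · exact hβB i
  obtain ⟨R, hR, hG, hav⟩ := hq (N₀ + 2 + N)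
  have hspike : ∀ ε ∈ cube p x, ∀ i < N₀ + 2 + N, Sum.elim ε (spike b q b i) ∈ R :=
    fun ε hε i hi => hG (Or.inl ⟨ε, hε, i, hi, rfl⟩)
  have hconst : ∀ ε ∈ puncturedCube p x, Sum.elim ε (fun _ => b) ∈ R :=
    fun ε hε => hG (Or.inr ⟨ε, hε, rfl⟩)
  -- for a fixed continuation `v`, the prefixes `ε` form a subpower
  have hsec : ∀ v : ℕ → A, IsSubpower L {ε : ι → A | Sum.elim ε v ∈ R} := by
    intro v k f r hr
    show _ ∈ R
    convert hR k f _ hr using 1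
    funext s
    rcases s with i | n
    · rfl
    · exact (hA k f _).symm
  have hd3 : ∀ v₁ v₂ v₃ : ℕ → A, ∀ ε : ι → A, Sum.elim ε v₁ ∈ R → Sum.elim ε v₂ ∈ R →
      Sum.elim ε v₃ ∈ R → Sum.elim ε (fun n => d.realize ![v₁ n, v₂ n, v₃ n]) ∈ R := by
    intro v₁ v₂ v₃ ε h₁ h₂ h₃
    convert hR.realize₃_mem d h₁ h₂ h₃ using 1
    funext s
    rcases s with i | n
    · exact (hA.realize₃ d _).symm
    · rfl
  -- the place `N₀ + 1` becomes the new cube coordinate, those before it are dropped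
  let R' : Set (Option ι ⊕ ℕ → A) := {r | ∃ g ∈ R, (∀ i, r (Sum.inl (some i)) = g (Sum.inl i)) ∧
    r (Sum.inl none) = g (Sum.inr (N₀ + 1)) ∧ (∀ n, r (Sum.inr n) = g (Sum.inr (N₀ + 2 + n))) ∧
    ∀ n ≤ N₀, g (Sum.inr n) ∈ B}
  -- spikes `q` at the new cube coordinate
  have hqb : ∀ ε ∈ cube p β, Sum.elim ε (spike b q b (N₀ + 1)) ∈ R := fun ε hε =>
    cube_subset_of_mem_closure hA (hsec (spike b q b (N₀ + 1)))
      (fun ε hε => hspike ε hε _ (by omega)) hβcl hε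
  have hbb : ∀ ε ∈ puncturedCube p β, Sum.elim ε (fun _ => b) ∈ R := fun ε hε =>
    puncturedCube_subset_of_mem_closure hA (hsec fun _ => b) hconst hβcl hε
  have hql : ∀ j < N, ∀ ε ∈ cube p β, Sum.elim ε (fun n => d.realize ![spike b q b (N₀ + 1) n,
      spike b q b (N₀ + 1) n, spike b q b (N₀ + 2 + j) n]) ∈ R := fun j hj ε hε =>
    cube_subset_of_mem_closure hA (hsec _) (fun ε hε => hd3 _ _ _ ε (hspike ε hε _ (by omega))
      (hspike ε hε _ (by omega)) (hspike ε hε _ (by omega))) hβcl hε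
  have hbl : ∀ j < N, ∀ ε ∈ puncturedCube p x, Sum.elim ε (fun n => d.realize ![b,
      b, spike b q b (N₀ + 2 + j) n]) ∈ R := fun j hj ε hε =>
    hd3 _ _ _ ε (hconst ε hε) (hconst ε hε) (hspike ε hε.1 _ (by omega))
  have hbl' : ∀ j < N, ∀ ε ∈ puncturedCube p β, Sum.elim ε (fun n => d.realize ![b,
      b, spike b q b (N₀ + 2 + j) n]) ∈ R := fun j hj ε hε =>
    puncturedCube_subset_of_mem_closure hA (hsec _) (fun ε hε => hbl j hj ε hε) hβcl hε
  have hkill : ∀ j < N, u ∈ {v : ι ⊕ ℕ → A | ∃ g ∈ R, (∀ i, g (Sum.inl i) = v (Sum.inl i)) ∧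
      (∀ n < N₀, g (Sum.inr n) = v (Sum.inr n)) ∧ g (Sum.inr N₀) ∈ B ∧
      g (Sum.inr (N₀ + 1)) = b ∧ ∀ n, g (Sum.inr (N₀ + 2 + n)) = spike b l b j n} := by
    intro j hj
    refine hu _ ?_ ?_
    · intro k f r hr
      choose g hgR h1 h2 h3 h4 h5 using hr
      refine ⟨_, hR k f g hgR, fun i => ?_, fun n hn => ?_, B.fun_mem f _ h3, ?_, fun n => ?_⟩
      · simp only [h1]
      · simp only [h2 _ n hn]
      · simp only [h4, hA k f]
      · simp only [h5, hA k f]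
    · rintro _ (⟨ε, hε, i, hi, rfl⟩ | ⟨ε, hε, rfl⟩)
      · refine ⟨_, hd3 _ _ _ ε (hspike ε hε i (by omega)) (hspike ε hε N₀ (by omega))
          (hspike ε hε (N₀ + 2 + j) (by omega)), fun _ => rfl, fun n hn => ?_, ?_, ?_, fun n => ?_⟩
        · have h1 : n ≠ N₀ := by omega
          have h2 : n ≠ N₀ + 2 + j := by omega
          simp only [Sum.elim_inr, spike, h1, h2, if_false, ite_self]
          split_ifs <;> first | rfl | exact hA.realize₃ d b
        · have h1 : N₀ ≠ i := by omega
          have h2 : N₀ ≠ N₀ + 2 + j := by omega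
          simpa only [Sum.elim_inr, spike, h1, h2, if_false, ite_self, lt_irrefl, if_true]
            using hdB b hb q b hb
        · have h1 : N₀ + 1 ≠ i := by omega
          have h2 : N₀ + 1 ≠ N₀ + 2 + j := by omega
          have h3 : N₀ + 1 ≠ N₀ := by omega
          simpa only [Sum.elim_inr, spike, h1, h2, h3, if_false, ite_self] using hA.realize₃ d b
        · have h1 : N₀ + 2 + n ≠ i := by omega
          have h3 : N₀ + 2 + n ≠ N₀ := by omega
          simp only [Sum.elim_inr, spike, h1, h3, if_false, ite_self, Nat.add_left_cancel_iff]
          split_ifs <;> first | rfl | omega | exact hA.realize₃ d b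
      · refine ⟨_, hbl j hj ε hε, fun _ => rfl, fun n hn => ?_, ?_, ?_, fun n => ?_⟩
        · have h2 : n ≠ N₀ + 2 + j := by omega
          simpa only [Sum.elim_inr, spike, h2, if_false, ite_self] using hA.realize₃ d b
        · have h2 : N₀ ≠ N₀ + 2 + j := by omega
          simpa only [Sum.elim_inr, spike, h2, if_false, ite_self, hA.realize₃ d b] using hb
        · have h2 : N₀ + 1 ≠ N₀ + 2 + j := by omega
          simpa only [Sum.elim_inr, spike, h2, if_false, ite_self] using hA.realize₃ d b
        · simp only [Sum.elim_inr, spike, Nat.add_left_cancel_iff]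
          split_ifs <;> first | rfl | omega | exact hA.realize₃ d b
  refine ⟨R', ?_, ?_, ?_⟩
  · intro k f r hr
    choose g hgR h1 h2 h3 h4 using hr
    refine ⟨_, hR k f g hgR, fun i => ?_, ?_, fun n => ?_,
      fun n hn => B.fun_mem f _ fun j => h4 j n hn⟩
    · simp only [h1]
    · simp only [h2]
    · simp only [h3]
  · -- a vertex of the new cube is a vertex `fun i => ε (some i)` of the old one and an end of the
    -- new edge
    rintro _ (⟨ε, hε, j, hj, rfl⟩ | ⟨ε, ⟨hε, o, ho⟩, rfl⟩)
    · have hε' : (fun i => ε (some i)) ∈ cube p β := fun i => hε (some i)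
      rcases hε none with h0 | h0
      · refine ⟨_, hql j hj _ hε', fun i => rfl, ?_, fun n => ?_, fun n hn => ?_⟩
        · have h2 : N₀ + 1 ≠ N₀ + 2 + j := by omega
          simp only [Sum.elim_inl, Sum.elim_inr, spike, h2, lt_irrefl, if_true, if_false, ite_self]
          exact h0.trans hdq.symm
        · have h1 : N₀ + 2 + n ≠ N₀ + 1 := by omega
          simp only [Sum.elim_inr, spike, h1, if_false, ite_self, Nat.add_left_cancel_iff]
          split_ifs <;> first | rfl | omega | exact (hA.realize₃ d b).symm
        · have h1 : n ≠ N₀ + 1 := by omega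
          have h2 : n ≠ N₀ + 2 + j := by omega
          simpa only [Sum.elim_inr, spike, h1, h2, if_false, ite_self, hA.realize₃ d b] using hb
      · by_cases hp : ∃ i, ε (some i) = p i
        · refine ⟨_, hbl' j hj _ ⟨hε', hp⟩, fun i => rfl, ?_, fun n => ?_, fun n hn => ?_⟩
          · have h2 : N₀ + 1 ≠ N₀ + 2 + j := by omega
            simp only [Sum.elim_inl, Sum.elim_inr, spike, h2, if_false, ite_self]
            exact h0.trans (hA.realize₃ d b).symm
          · simp only [Sum.elim_inr, spike, Nat.add_left_cancel_iff]
            split_ifs <;> first | rfl | omega | exact (hA.realize₃ d b).symm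
          · have h2 : n ≠ N₀ + 2 + j := by omega
            simpa only [Sum.elim_inr, spike, h2, if_false, ite_self, hA.realize₃ d b] using hb
        · push Not at hp
          obtain ⟨g, hgR, h1, h2, h3, h4, h5⟩ := hkill j hj
          refine ⟨g, hgR, fun i => ?_, h0.trans h4.symm, fun n => (h5 n).symm, fun n hn => ?_⟩
          · rw [h1]
            exact (hε (some i)).resolve_left (hp i)
          · rcases hn.lt_or_eq with hn | rfl
            · rw [h2 n hn]
              exact huB (Sum.inr n) fun m hm => Sum.inr.inj hm ▸ hn
            · exact h3
    · have hε' : (fun i => ε (some i)) ∈ cube p β := fun i => hε (some i)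
      by_cases h0 : ε none = q
      · refine ⟨_, hqb _ hε', fun i => rfl, ?_, fun n => ?_, fun n hn => ?_⟩
        · simpa [spike] using h0
        · have h1 : N₀ + 2 + n ≠ N₀ + 1 := by omega
          simp only [Sum.elim_inr, spike, h1, if_false, ite_self]
        · have h1 : n ≠ N₀ + 1 := by omega
          simpa only [Sum.elim_inr, spike, h1, if_false, ite_self] using hb
      · have hp : ∃ i, ε (some i) = p i := by
          rcases o with _ | i
          · exact absurd ho h0
          · exact ⟨i, ho⟩
        exact ⟨_, hbb _ ⟨hε', hp⟩, fun i => rfl, (hε none).resolve_left h0, fun n => rfl,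
          fun n _ => hb⟩
  · rintro r ⟨g, hgR, h1, h2, h3, h4⟩
    obtain ⟨s, hs, hsB⟩ := hav g hgR
    rcases s with i | n
    · exact ⟨Sum.inl (some i), by simp, by rwa [h1]⟩
    · have hn : n < N₀ + 2 + N := hs n rfl
      have hn' : N₀ < n := by
        by_contra hle
        exact hsB (h4 n (by omega))
      rcases Nat.lt_or_ge (N₀ + 1) n with hlt | hge
      · refine ⟨Sum.inr (n - (N₀ + 2)), fun m hm => ?_, ?_⟩
        · rw [← Sum.inr.inj hm]
          omega
        · rw [h3, show N₀ + 2 + (n - (N₀ + 2)) = n by omega]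
          exact hsB
      · refine ⟨Sum.inl none, by simp, ?_⟩
        rw [h2, show N₀ + 1 = n by omega]
        exact hsB

theorem IsBadSpike.exists_puncturedCube_avoids [Finite A] (hA : IsIdempotentAlgebra L A)
    {B : L.Substructure A} (hJ : JonssonAbsorbs B) {b q : A} (hb : b ∈ B)
    (h : IsBadSpike L (B : Set A) b q b) (k : ℕ) :
    ∃ (ι : Type) (_ : Fintype ι) (p x : ι → A), Fintype.card ι = k ∧ (∀ i, x i ∈ B) ∧
      Avoids L (B : Set A) Set.univ (puncturedCube p x) := by
  suffices H : ∃ (ι : Type) (_ : Fintype ι) (p x : ι → A) (q' : A), Fintype.card ι = k ∧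
      (∀ i, x i ∈ B) ∧ IsBadCube L (B : Set A) p x b q' by
    obtain ⟨ι, hι, p, x, q', hk, hx, hbad⟩ := H
    obtain ⟨R, hR, hG, hav⟩ := hbad 0
    refine ⟨ι, hι, p, x, hk, hx, {ε | ∃ r ∈ R, ∀ i, ε i = r (Sum.inl i)}, ?_, ?_, ?_⟩
    · intro k f ε hε
      choose r hr hεr using hε
      exact ⟨_, hR k f r hr, fun i => by simp only [hεr]⟩
    · exact fun ε hε => ⟨_, hG (Or.inr ⟨ε, hε, rfl⟩), fun i => rfl⟩
    · rintro ε ⟨r, hr, hεr⟩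
      obtain ⟨s, hs, hsB⟩ := hav r hr
      rcases s with i | n
      · exact ⟨i, Set.mem_univ i, by rwa [hεr]⟩
      · exact absurd (hs n rfl) (Nat.not_lt_zero n)
  induction k with
  | zero =>
    exact ⟨Empty, inferInstance, Empty.elim, Empty.elim, q, rfl, fun i => i.elim,
      h.isBadCube _ _⟩
  | succ k ih =>
    obtain ⟨ι, hι, p, x, q', hk, hx, hbad⟩ := ih
    obtain ⟨p', x', q'', hx', hbad'⟩ := hbad.exists_option hA hJ hx hb
    exact ⟨Option ι, inferInstance, p', x', q'', by rw [Fintype.card_option, hk], hx', hbad'⟩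

theorem Avoids.puncturedCube_comp (hA : IsIdempotentAlgebra L A) {B : Set A} {ι κ : Type*}
    {p x : ι → A} (hx : ∀ i, x i ∈ B) (h : Avoids L B Set.univ (puncturedCube p x)) {φ : κ → ι}
    (hφ : Function.Injective φ) :
    Avoids L B Set.univ (puncturedCube (p ∘ φ) (x ∘ φ)) := by
  classical
  obtain ⟨R, hR, hG, hav⟩ := h
  have hout : ∀ (ε : κ → A) (i : ι), (¬ ∃ j, φ j = i) → Function.extend φ ε x i = x i :=
    fun ε i hi => Function.extend_apply' _ _ _ hi
  refine ⟨{ε | Function.extend φ ε x ∈ R}, ?_, ?_, ?_⟩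
  · intro k f r hr
    show _ ∈ R
    convert hR k f _ hr using 1
    funext i
    by_cases hi : ∃ j, φ j = i
    · obtain ⟨j, rfl⟩ := hi
      simp only [hφ.extend_apply]
    · simp only [hout _ _ hi]
      exact (hA k f _).symm
  · rintro ε ⟨hε, j, hj⟩
    refine hG ⟨fun i => ?_, φ j, by rw [hφ.extend_apply]; exact hj⟩
    by_cases hi : ∃ j, φ j = i
    · obtain ⟨j, rfl⟩ := hi
      rw [hφ.extend_apply]
      exact hε j
    · exact Or.inr (hout _ _ hi)
  · intro ε hε
    obtain ⟨i, -, hi⟩ := hav _ hε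
    by_cases hj : ∃ j, φ j = i
    · obtain ⟨j, rfl⟩ := hj
      rw [hφ.extend_apply] at hi
      exact ⟨j, Set.mem_univ j, hi⟩
    · rw [hout _ _ hj] at hi
      exact absurd (hx i) hi

/-- By the pigeonhole principle, cubes of all dimensions can be taken with the same edge in all
directions. -/
theorem exists_forall_puncturedCube_avoids [Finite A] (hA : IsIdempotentAlgebra L A)
    {B : L.Substructure A} (hJ : JonssonAbsorbs B) (h : ¬ Absorbs B) :
    ∃ a, ∃ b ∈ B, ∀ n : ℕ,
      Avoids L (B : Set A) Set.univ (puncturedCube (fun _ : Fin n => a) fun _ => b) := by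
  classical
  have := Fintype.ofFinite A
  obtain ⟨y, hy, x₀, hx₀, a₀, h₀⟩ := exists_isBadSpike_of_not_absorbs hA h
  obtain ⟨b₀, hb₀, q₀, hq₀⟩ := exists_isBadSpike_diag hA hJ hy hx₀ h₀
  by_contra! hno
  choose n hn using fun c : A × B => hno c.1 c.2 c.2.2
  set m := Finset.univ.sup n
  obtain ⟨ι, hι, p, x, hk, hx, hav⟩ :=
    hq₀.exists_puncturedCube_avoids hA hJ hb₀ (Fintype.card (A × B) * m)
  have : Nonempty (A × B) := ⟨(q₀, ⟨b₀, hb₀⟩)⟩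
  let edge : ι → A × B := fun i => (p i, ⟨x i, hx i⟩)
  obtain ⟨c, hc⟩ := Fintype.exists_le_card_fiber_of_mul_le_card edge hk.ge
  have hle : n c ≤ Fintype.card {i // edge i = c} := by
    rw [Fintype.card_subtype]
    exact (Finset.le_sup (Finset.mem_univ c)).trans hc
  obtain ⟨φ⟩ : Nonempty (Fin (n c) ↪ {i // edge i = c}) :=
    Function.Embedding.nonempty_of_card_le (by simpa using hle)
  have hp : ∀ j, p (φ j) = c.1 := fun j => congrArg Prod.fst (φ j).2
  have hxc : ∀ j, x (φ j) = c.2 := fun j => congrArg (fun c => (c.2 : A)) (φ j).2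
  have hav' := hav.puncturedCube_comp hA hx (φ := fun j => (φ j : ι))
    fun i j hij => φ.injective (Subtype.ext hij)
  rw [show p ∘ (fun j => (φ j : ι)) = fun _ => c.1 from funext hp,
    show x ∘ (fun j => (φ j : ι)) = fun _ => (c.2 : A) from funext hxc] at hav'
  exact hn c hav'

/-! ### Maximal crosses are blockers -/

/-- The tuples over `D` with at least one entry in `C`. -/
def cross {J : Type*} (C D : Set A) : Set (J → A) := {x | (∀ i, x i ∈ D) ∧ ∃ i, x i ∈ C}

theorem Avoids.cross_of_equiv {B C D : Set A} {J K : Type*} (σ : J ≃ K)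
    (h : Avoids L B Set.univ (cross C D : Set (J → A))) :
    Avoids L B Set.univ (cross C D : Set (K → A)) := by
  obtain ⟨R, hR, hG, hav⟩ := h
  refine ⟨{r | (fun j => r (σ j)) ∈ R}, fun k f r hr => hR k f _ hr, ?_, fun r hr => ?_⟩
  · rintro r ⟨hD, k, hk⟩
    exact hG ⟨fun j => hD _, σ.symm k, by simpa using hk⟩
  · obtain ⟨j, -, hj⟩ := hav _ hr
    exact ⟨σ j, Set.mem_univ _, hj⟩

theorem Avoids.cross_closure (hA : IsIdempotentAlgebra L A) {B C D : Set A} {J : Type*} [Finite J]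
    (hCD : C ⊆ D) (h : Avoids L B Set.univ (cross C D : Set (J → A))) :
    Avoids L B Set.univ (cross C (Substructure.closure L D : Set A) : Set (J → A)) := by
  classical
  obtain ⟨R, hR, hG, hav⟩ := h
  refine ⟨R, hR, ?_, hav⟩
  rintro x ⟨hxD, i₀, hi₀⟩
  refine hR.mem_of_forall_mem_closure hA (fun i => if i = i₀ then {x i₀} else D)
    (fun y hy => hG ⟨fun i => ?_, i₀, ?_⟩) x fun i => ?_
  · have := hy i
    split_ifs at this
    · rw [Set.mem_singleton_iff.1 this]
      exact hCD hi₀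
    · exact this
  · have := hy i₀
    simp only [if_true, Set.mem_singleton_iff] at this
    rwa [this]
  · split_ifs with hi
    · subst hi
      exact Substructure.subset_closure rfl
    · exact hxD i

/-- If all crosses over `(C, D)` avoid `B`, while for each `e ∈ D \ C` some cross over
`(C ∪ {e}, D)` does not, then the crosses over `(C, D)` are subpowers. An operation leading out
of a cross produces values `e j ∈ D \ C`, one for each of its arguments; the crosses over
`(C ∪ {e j}, D)` that do not avoid `B`, put side by side, lie in the subpower generated by a cross
over `(C, D)`. -/
theorem isSubpower_cross (hA : IsIdempotentAlgebra L A) {B C : Set A} (D : L.Substructure A)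
    (hav : ∀ n : ℕ, Avoids L B Set.univ (cross C D : Set (Fin n → A)))
    (hmax : ∀ e ∈ D, e ∉ C → ∃ n : ℕ,
      ¬ Avoids L B Set.univ (cross (insert e C) D : Set (Fin n → A))) (J : Type*) :
    IsSubpower L (cross C D : Set (J → A)) := by
  classical
  intro k f r hr
  have hD : ∀ i, Structure.funMap f (fun j => r j i) ∈ D :=
    fun i => D.fun_mem f _ fun j => (hr j).1 i
  refine ⟨hD, ?_⟩
  by_contra! hC
  choose i hi using fun j => (hr j).2
  set e : Fin k → A := fun j => Structure.funMap f fun l => r l (i j) with he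
  choose n hn using fun j => hmax (e j) (hD (i j)) (hC (i j))
  choose z hzB hz using fun j => exists_mem_of_not_avoids (hn j)
  obtain ⟨R, hR, hG, hRB⟩ := Avoids.cross_of_equiv
    (Fintype.equivFin (Σ j : Fin k, Fin (n j))).symm (hav _)
  suffices hzR : (fun s : Σ j : Fin k, Fin (n j) => z s.1 s.2) ∈ R by
    obtain ⟨⟨j, s⟩, -, hjs⟩ := hRB _ hzR
    exact hjs (hzB j s (Set.mem_univ s))
  refine hR.mem_of_blocks hA (fun j => cross (insert (e j) C) D) (fun y hy => ?_) z hz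
  by_cases hyC : ∃ j s, y j s ∈ C
  · obtain ⟨j, s, hjs⟩ := hyC
    exact hG ⟨fun s => (hy s.1).1 s.2, ⟨j, s⟩, hjs⟩
  push Not at hyC
  -- without entries in `C`, the tuple is the value of `f` at tuples of the cross over `(C, D)`
  choose s hs using fun j => (hy j).2
  have hse : ∀ j, y j (s j) = e j := fun j =>
    (Set.mem_insert_iff.1 (hs j)).resolve_right (hyC j (s j))
  convert hR k f (fun l q => if q.2 = s q.1 then r l (i q.1) else y q.1 q.2) fun l =>
    hG ⟨fun q => ?_, ⟨l, s l⟩, ?_⟩ using 1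
  · funext ⟨j, q⟩
    by_cases hq : q = s j
    · subst hq
      simp only [if_true, hse, he]
    · simp only [hq, if_false]
      exact (hA k f _).symm
  · dsimp only
    split_ifs
    · exact (hr l).1 _
    · exact (hy q.1).1 _
  · simpa using hi l

theorem exists_isBlocker_of_forall_avoids [Finite A] (hA : IsIdempotentAlgebra L A)
    {B : L.Substructure A} {a b : A} (hb : b ∈ B) (h : ∀ n : ℕ,
      Avoids L (B : Set A) Set.univ (puncturedCube (fun _ : Fin n => a) fun _ => b)) :
    ∃ (C : Set A) (D : L.Substructure A), IsBlocker B C D := by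
  classical
  let P : Set A × Set A → Prop := fun S => S.1.Nonempty ∧ S.1 ⊆ S.2 ∧ (S.2 ∩ B).Nonempty ∧
    ∀ n : ℕ, Avoids L (B : Set A) Set.univ (cross S.1 S.2 : Set (Fin n → A))
  have hP : P ({a}, {a, b}) := by
    refine ⟨⟨a, rfl⟩, by simp, ⟨b, by simp, hb⟩, fun n => ?_⟩
    obtain ⟨R, hR, hG, hav⟩ := h n
    exact ⟨R, hR, fun x hx => hG hx, hav⟩
  obtain ⟨⟨C, D⟩, -, ⟨hC, hCD, hDB, hav⟩, hmax⟩ := exists_maximal_ge_of_wellFoundedGT P _ hP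
  have hD : (Substructure.closure L D : Set A) = D := by
    refine Set.Subset.antisymm ?_ Substructure.subset_closure
    exact (hmax (y := (C, (Substructure.closure L D : Set A))) ⟨hC,
      hCD.trans Substructure.subset_closure,
      hDB.mono (Set.inter_subset_inter_left _ Substructure.subset_closure),
      fun n => (hav n).cross_closure hA hCD⟩ ⟨le_rfl, Substructure.subset_closure⟩).2
  refine ⟨C, Substructure.closure L D, hC, hD.symm ▸ hCD, ?_, hD.symm ▸ hDB, fun n hn => ?_⟩
  · rw [Set.eq_empty_iff_forall_notMem]
    rintro c ⟨hcC, hcB⟩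
    obtain ⟨R, -, hG, hRB⟩ := hav 1
    obtain ⟨i, -, hi⟩ := hRB _ (hG (⟨fun _ => hCD hcC, 0, hcC⟩ : (fun _ => c) ∈ cross C D))
    exact hi hcB
  · have := isSubpower_cross hA (B := (B : Set A)) (C := C) (Substructure.closure L D)
      (by rwa [hD]) (fun e he heC => ?_) (Fin n)
    · convert this using 1
      ext x
      simp only [cross, Set.mem_sdiff, Set.mem_ofPred_eq, not_forall, not_and, not_not]
      constructor
      · rintro ⟨h1, i, hi⟩
        exact ⟨h1, i, hi (h1 i)⟩
      · rintro ⟨h1, i, hi⟩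
        exact ⟨h1, i, fun _ => hi⟩
    · rw [hD]
      by_contra! hall
      have he' : e ∈ D := hD ▸ he
      exact heC ((hmax (y := (insert e C, D)) ⟨Set.insert_nonempty _ _,
        Set.insert_subset he' hCD, hDB, hall⟩ ⟨Set.subset_insert _ _, le_rfl⟩).1
        (Set.mem_insert e C))

end Absorption

theorem theorem1p2 {L : FirstOrder.Language.{u, v}} [L.IsAlgebraic] {A : Type w} [L.Structure A]
    [Finite A] (hA : Absorption.IsIdempotentAlgebra L A) (B : L.Substructure A) :
    Absorption.Absorbs B ↔
      Absorption.JonssonAbsorbs B ∧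
        ¬ ∃ (C : Set A) (D : L.Substructure A), Absorption.IsBlocker B C D := by
  refine ⟨fun h => ⟨h.jonssonAbsorbs, fun ⟨C, D, hCD⟩ => h.not_isBlocker C D hCD⟩, ?_⟩
  rintro ⟨hJ, hno⟩
  by_contra h
  obtain ⟨a, b, hb, hav⟩ := Absorption.exists_forall_puncturedCube_avoids hA hJ h
  exact hno (Absorption.exists_isBlocker_of_forall_avoids hA hb hav)
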